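/- Let $(N(t))_{t\in\mathbb R}$ be a two-sided Poisson process with unit intensity, let $B$ be a random variable independent of $N$ with $\mathbb P(B=1)=\mathbb P(B=-1)=\tfrac12$, and put $X(t)=B\,(-1)^{N(t)}$. Let $W:\mathbb R\to\mathbb R$ be even and continuous, let $T>0$, and let $-T\le t_1\le\dots\le t_N\le T$. Put $$Z(W,T)=\mathbb E\Big[\exp\Big(\int_{-T}^T\int_{-T}^T W(t-s)X(t)X(s)\,dt\,ds\Big)\Big].$$ For $\delta>0$ let $i_\delta(t)=\lfloor t/\delta+\tfrac12\rfloor\in\mathbb Z$, $L=i_\delta(T)$ and $\Lambda=\{-L,\dots,L\}$. Let $\langle\,\cdot\,\rangle_{\delta,T}$ be the expectation with respect to the Ising (Gibbs) probability measure on $\{-1,1\}^{\Lambda}$ which gives $\sigma=(\sigma_i)_{i\in\Lambda}$ a weight proportional to $$\exp\Big(-\tfrac12\ln(\delta)\sum_{i=-L}^{L-1}\sigma_i\sigma_{i+1}+\sum_{\substack{i,j\in\Lambda\\ i\ne j}}\delta^2\,W(\delta|i-j|)\,\sigma_i\sigma_j\Big),$$ where the second sum runs over ordered pairs $(i,j)$;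 that is, the unordered pair $\{i,j\}$ has total coupling $2\delta^2W(\delta|i-j|)$, plus $-\tfrac12\ln\delta$ if $|i-j|=1$. Then $$\lim_{\delta\downarrow0}\big\langle\sigma_{i_\delta(t_1)}\cdots\sigma_{i_\delta(t_N)}\big\rangle_{\delta,T}=\frac1{Z(W,T)}\,\mathbb E\Big[X(t_1)\cdots X(t_N)\exp\Big(\int_{-T}^T\int_{-T}^T W(t-s)X(t)X(s)\,dt\,ds\Big)\Big].$$ -/

import Mathlib

open MeasureTheory ProbabilityTheory Filter Topology

noncomputable section

namespace ContinuumIsing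

/-! ### The Ising model on the lattice `{-L, …, L}` -/

/-- The lattice `Λ_L = ℤ ∩ [-L, L]`. -/
def lattice (L : ℕ) : Finset ℤ := Finset.Icc (-(L : ℤ)) L

/-- The configuration space `{-1, 1} ^ Λ_L`. -/
abbrev Config (L : ℕ) : Type := {i : ℤ // i ∈ lattice L} → ℤˣ

/-- The spin `σ_i` as a real number. Only sites of the lattice are ever used; the value `1`
elsewhere is a convention that makes the function total. -/
def spin {L : ℕ} (σ : Config L) (i : ℤ) : ℝ :=
  if h : i ∈ lattice L then ((σ ⟨i, h⟩ : ℤ) : ℝ) else 1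

/-- The Ising energy `E_{J,L}(σ) = - ∑_{A ⊆ Λ_L} J(A) ∏_{i ∈ A} σ_i`. -/
def isingEnergy (J : Finset ℤ → ℝ) (L : ℕ) (σ : Config L) : ℝ :=
  -∑ A ∈ (lattice L).powerset, J A * ∏ i ∈ A, spin σ i

/-- The partition function `Z_{J,L}`. -/
def isingPartition (J : Finset ℤ → ℝ) (L : ℕ) : ℝ :=
  ∑ σ : Config L, Real.exp (-isingEnergy J L σ)

/-- The Ising expectation of `f` on the lattice `Λ_L` with interaction `J`. -/
def isingExpectation (J : Finset ℤ → ℝ) (L : ℕ) (f : Config L → ℝ) : ℝ :=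
  (isingPartition J L)⁻¹ * ∑ σ : Config L, f σ * Real.exp (-isingEnergy J L σ)

/-- The pair interaction `J_w` of a sequence `w`: `J_w {i, j} = w_{|i - j|}` for `i ≠ j`, and
`J_w A = 0` if `A` does not have exactly two elements. See `pairInteraction_pair`. -/
def pairInteraction (w : ℕ → ℝ) (A : Finset ℤ) : ℝ :=
  if h : A.card = 2 then
    w (A.max' (Finset.card_pos.1 (by omega)) - A.min' (Finset.card_pos.1 (by omega))).natAbs
  else 0

theorem pairInteraction_pair (w : ℕ → ℝ) {i j : ℤ} (hij : i ≠ j) :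
    pairInteraction w {i, j} = w (i - j).natAbs := by
  have h : ({i, j} : Finset ℤ).card = 2 := Finset.card_pair hij
  rw [pairInteraction, dif_pos h, Finset.max'_pair, Finset.min'_pair]
  congr 1
  rcases le_total i j with h' | h' <;> (simp [h']; try omega)

theorem pairInteraction_of_card_ne (w : ℕ → ℝ) {A : Finset ℤ} (hA : A.card ≠ 2) :
    pairInteraction w A = 0 := by
  rw [pairInteraction, dif_neg hA]

/-! ### The scaled lattice model with spacing `δ` -/

/-- The lattice site `⌊t / δ + 1 / 2⌋` belonging to the time `t`. -/
def site (δ t : ℝ) : ℤ := ⌊t / δ + 1 / 2⌋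

/-- The size `L_δ(T) = ⌊T / δ + 1 / 2⌋` of the lattice belonging to `[-T, T]`. -/
def latticeSize (δ T : ℝ) : ℕ := ⌊T / δ + 1 / 2⌋₊

/-- The times in `[-T, T]` have their sites in the lattice. -/
theorem site_mem_lattice {δ T t : ℝ} (hδ : 0 < δ) (ht : t ∈ Set.Icc (-T) T) :
    site δ t ∈ lattice (latticeSize δ T) := by
  have hT : 0 ≤ T := by linarith [ht.1, ht.2]
  have h0 : 0 ≤ T / δ + 1 / 2 := by positivity
  have h1 : t / δ ≤ T / δ := by gcongr; exact ht.2
  have h2 : -(T / δ) ≤ t / δ := by rw [← neg_div]; gcongr; exact ht.1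
  have hL : ((latticeSize δ T : ℕ) : ℤ) = ⌊T / δ + 1 / 2⌋ := by
    rw [latticeSize, Int.natCast_floor_eq_floor h0]
  rw [lattice, Finset.mem_Icc, hL, site]
  refine ⟨?_, Int.floor_le_floor (by linarith)⟩
  rw [Int.le_floor]
  push_cast
  by_contra! hc
  have h3 := Int.floor_le (T / δ + 1 / 2)
  have h4 := Int.lt_floor_add_one (T / δ + 1 / 2)
  linarith

/-- The nearest-neighbour coupling `j_δ = -(1/2) ln δ`. -/
def nnCoupling (δ : ℝ) : ℝ := -(1 / 2) * Real.log δ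

/-- The long-range coupling `w^(δ)_k = δ² W(δ k)`. -/
def longRangeCoupling (W : ℝ → ℝ) (δ : ℝ) (k : ℕ) : ℝ := δ ^ 2 * W (δ * k)

/-- The interaction of the scaled model. The Gibbs weight `exp (-E)` is
`exp (j_δ ∑_{i = -L}^{L - 1} σ_i σ_{i+1} + ∑_{i ≠ j} w^(δ)_{|i - j|} σ_i σ_j)`, where the last sum
runs over the *ordered* pairs `(i, j)`. In `isingEnergy` every unordered pair `{i, j}` occurs
only once, whence the factor `2`. -/
def scaledInteraction (W : ℝ → ℝ) (δ : ℝ) : Finset ℤ → ℝ :=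
  pairInteraction fun k ↦ (if k = 1 then nnCoupling δ else 0) + 2 * longRangeCoupling W δ k

/-- The correlation of the spins at the sites of the times `t 0, …, t (n - 1)` in the scaled
model on `[-T, T]`. -/
def latticeCorrelation (W : ℝ → ℝ) (T δ : ℝ) {n : ℕ} (t : Fin n → ℝ) : ℝ :=
  isingExpectation (scaledInteraction W δ) (latticeSize δ T)
    fun σ ↦ ∏ k, spin σ (site δ (t k))

/-! ### The jump process -/

variable {Ω : Type*} [MeasurableSpace Ω]

/-- A two-sided Poisson process with unit intensity: an integer-valued process `N(t)`, `t ∈ ℝ`,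
with `N(0) = 0`, whose increments over disjoint intervals are independent, whose increment over
`[s, t]` is Poisson distributed with mean `t - s`, and whose paths are almost surely
nondecreasing and right-continuous. -/
structure IsTwoSidedPoissonProcess (N : ℝ → Ω → ℤ) (P : Measure Ω) : Prop where
  measurable (t : ℝ) : Measurable (N t)
  zero : ∀ᵐ ω ∂P, N 0 ω = 0
  indep_increments : HasIndepIncrements N P
  law_increment (s t : ℝ) (hst : s ≤ t) :
    HasLaw (fun ω ↦ N t ω - N s ω)
      ((poissonMeasure (t - s).toNNReal).map (fun k : ℕ ↦ (k : ℤ))) P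
  paths : ∀ᵐ ω ∂P, Monotone (fun t ↦ N t ω) ∧
    ∀ t, ContinuousWithinAt (fun s ↦ N s ω) (Set.Ici t) t

/-- The jump process `X(t) = B (-1)^{N(t)}`. -/
def jumpProcess (B : Ω → ℝ) (N : ℝ → Ω → ℤ) (t : ℝ) (ω : Ω) : ℝ := B ω * (-1 : ℝ) ^ N t ω

/-- `exp (∫_{-T}^T ∫_{-T}^T W(t - s) X(t) X(s) dt ds)`. -/
def pathWeight (W : ℝ → ℝ) (T : ℝ) (X : ℝ → Ω → ℝ) (ω : Ω) : ℝ :=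
  Real.exp (∫ s in (-T)..T, ∫ t in (-T)..T, W (t - s) * X t ω * X s ω)

/-- The canonical partition function `Z(W, T) = E[exp (∫∫ W(t - s) X(t) X(s) dt ds)]`. -/
def jumpPartition (W : ℝ → ℝ) (T : ℝ) (X : ℝ → Ω → ℝ) (P : Measure Ω) : ℝ :=
  ∫ ω, pathWeight W T X ω ∂P

end ContinuumIsing

end

open ContinuumIsing

namespace ContinuumIsing

/-! ### Finite-dimensional laws and almost sure continuity of the jump process -/

section Poisson

variable {Ω : Type*} [MeasurableSpace Ω] {P : Measure Ω} {N : ℝ → Ω → ℤ} {B : Ω → ℝ}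

/-! The lattice model is realised exactly on the probability space of the jump process, so no weak
convergence is needed. Over a time step `h` the process `X` keeps or flips its sign with
probabilities `(1 ± exp (-2h)) / 2`. For `h = artanh δ` these are `1 / (1 + δ)` and `δ / (1 + δ)`,
with ratio `δ = exp (-2 j_δ)`. Hence `X` sampled at the times `h i` is the free nearest-neighbour
Ising chain with coupling `j_δ` (`flip_weight`, `measureReal_configOf_jumpProcess`). The long-range
part of the Gibbs weight becomes a density with respect to this law, and the lattice correlation is
a quotient of two expectations over the same process (`latticeCorrelation_eq`).

The limit is then dominated convergence. Since `artanh δ / δ → 1`, the sampling times converge to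
the original times, where `X` is almost surely continuous (`ae_continuousAt`). Almost every path
takes values `±1` and has countably many jumps, so the long-range sum, a Riemann sum of the double
integral, converges along it (`tendsto_longRangeSum`). The sums are bounded uniformly in `δ` and in
the path (`exists_abs_longRangeSum_le`); this dominates the integrands and keeps the limiting
denominator positive. -/

theorem integral_neg_one_pow_poissonMeasure (r : NNReal) :
    ∫ k, (-1 : ℝ) ^ k ∂(poissonMeasure r) = Real.exp (-2 * r) := by
  rw [integral_poissonMeasure]
  have h : ∀ k : ℕ, (Real.exp (-(r : ℝ)) * (r : ℝ) ^ k / (k.factorial : ℝ)) • (-1 : ℝ) ^ k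
      = Real.exp (-(r : ℝ)) * ((-(r : ℝ)) ^ k / (k.factorial : ℝ)) := by
    intro k
    rw [smul_eq_mul, neg_pow (r : ℝ)]
    ring
  simp_rw [h]
  rw [tsum_mul_left, ← congrFun (NormedSpace.exp_eq_tsum_div (𝔸 := ℝ)) (-(r : ℝ)),
    ← Real.exp_eq_exp_ℝ, ← Real.exp_add]
  congr 1
  ring

namespace IsTwoSidedPoissonProcess

theorem integral_neg_one_zpow_increment (hN : IsTwoSidedPoissonProcess N P) {s t : ℝ}
    (hst : s ≤ t) :
    ∫ ω, (-1 : ℝ) ^ (N t ω - N s ω) ∂P = Real.exp (-2 * (t - s)) := by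
  have hlaw := hN.law_increment s t hst
  have h := hlaw.integral_comp (f := fun z : ℤ ↦ (-1 : ℝ) ^ z)
    (measurable_from_top.aestronglyMeasurable)
  have h' : ∫ ω, (-1 : ℝ) ^ (N t ω - N s ω) ∂P = ∫ z, (-1 : ℝ) ^ z
      ∂((poissonMeasure (t - s).toNNReal).map (fun k : ℕ ↦ (k : ℤ))) := h
  rw [h', integral_map (measurable_from_top.aemeasurable)
    (measurable_from_top.aestronglyMeasurable)]
  simp only [zpow_natCast]
  rw [integral_neg_one_pow_poissonMeasure, Real.coe_toNNReal _ (by linarith)]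

theorem measureReal_increment_parity [IsProbabilityMeasure P]
    (hN : IsTwoSidedPoissonProcess N P) {s t : ℝ} (hst : s ≤ t) {c : ℝ} (hc : c = 1 ∨ c = -1) :
    P.real {ω | (-1 : ℝ) ^ (N t ω - N s ω) = c} = (1 + c * Real.exp (-2 * (t - s))) / 2 := by
  have hmeas : Measurable (fun ω ↦ (-1 : ℝ) ^ (N t ω - N s ω)) :=
    (measurable_from_top (f := fun z : ℤ ↦ (-1 : ℝ) ^ z)).comp
      ((hN.measurable t).sub (hN.measurable s))
  have hset : MeasurableSet {ω | (-1 : ℝ) ^ (N t ω - N s ω) = c} :=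
    hmeas (measurableSet_singleton c)
  -- For signs `ε` and `c`, the indicator of `ε = c` is `(1 + c ε) / 2`, so the mean determines the
  -- probability.
  have hpt : Set.indicator {ω | (-1 : ℝ) ^ (N t ω - N s ω) = c} (1 : Ω → ℝ)
      = fun ω ↦ 1 / 2 + c / 2 * (-1 : ℝ) ^ (N t ω - N s ω) := by
    ext ω
    rcases Int.even_or_odd (N t ω - N s ω) with h | h <;> rcases hc with rfl | rfl <;>
      simp [Set.indicator, h.neg_one_zpow] <;> norm_num
  have hint : Integrable (fun ω ↦ (-1 : ℝ) ^ (N t ω - N s ω)) P :=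
    Integrable.of_bound hmeas.aestronglyMeasurable 1 (by simp)
  rw [← integral_indicator_one hset, hpt, integral_add (integrable_const _)
    (hint.const_mul _), integral_const_mul, hN.integral_neg_one_zpow_increment hst]
  simp
  ring

theorem measureReal_parities [IsProbabilityMeasure P]
    (hN : IsTwoSidedPoissonProcess N P) {a : ℕ → ℝ} (ha : Monotone a) {c : ℕ → ℝ}
    (hc : ∀ k, c k = 1 ∨ c k = -1) (m : ℕ) :
    P.real {ω | ∀ k < m, (-1 : ℝ) ^ (N (a (k + 1)) ω - N (a k) ω) = c k}
      = ∏ k ∈ Finset.range m, (1 + c k * Real.exp (-2 * (a (k + 1) - a k))) / 2 := by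
  have h := (hN.indep_increments.nat ha).measure_inter_preimage_eq_mul (Finset.range m)
    (sets := fun k ↦ {z : ℤ | (-1 : ℝ) ^ z = c k}) (fun _ _ ↦ MeasurableSet.of_discrete)
  have hset : {ω | ∀ k < m, (-1 : ℝ) ^ (N (a (k + 1)) ω - N (a k) ω) = c k}
      = ⋂ k ∈ Finset.range m, (fun ω ↦ N (a (k + 1)) ω - N (a k) ω) ⁻¹'
        {z : ℤ | (-1 : ℝ) ^ z = c k} := by
    ext ω
    simp
  rw [hset, measureReal_def, h, ENNReal.toReal_prod]
  refine Finset.prod_congr rfl fun k _ ↦ ?_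
  rw [← hN.measureReal_increment_parity (ha k.le_succ) (hc k)]
  rfl

/-- Flips between consecutive times determine the signs only up to one global sign. The fair sign
`B` later resolves this ambiguity. -/
theorem setOf_parities_eq_union {Ω : Type*} {N : ℝ → Ω → ℤ} {a : ℕ → ℝ} {s : ℕ → ℝ}
    (hs : ∀ k, s k = 1 ∨ s k = -1) (m : ℕ) :
    {ω | ∀ k < m, (-1 : ℝ) ^ (N (a (k + 1)) ω - N (a k) ω) = s k * s (k + 1)}
      = {ω | ∀ k ≤ m, (-1 : ℝ) ^ N (a k) ω = s k} ∪
        {ω | ∀ k ≤ m, (-1 : ℝ) ^ N (a k) ω = -s k} := by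
  have hss : ∀ k, s k * s k = 1 := fun k ↦ by rcases hs k with h | h <;> simp [h]
  have hsub : ∀ x y : ℤ, (-1 : ℝ) ^ (x - y) = (-1 : ℝ) ^ y * (-1 : ℝ) ^ x := fun x y ↦ by
    rcases Int.even_or_odd x with hx | hx <;> rcases Int.even_or_odd y with hy | hy
    · simp [hx.neg_one_zpow, hy.neg_one_zpow, (hx.sub hy).neg_one_zpow]
    · simp [hx.neg_one_zpow, hy.neg_one_zpow, (hx.sub_odd hy).neg_one_zpow]
    · simp [hx.neg_one_zpow, hy.neg_one_zpow, (hx.sub_even hy).neg_one_zpow]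
    · simp [hx.neg_one_zpow, hy.neg_one_zpow, (hx.sub_odd hy).neg_one_zpow]
  have hsq : ∀ x : ℤ, (-1 : ℝ) ^ x * (-1 : ℝ) ^ x = 1 := fun x ↦ by
    rcases Int.even_or_odd x with hx | hx <;> simp [hx.neg_one_zpow]
  ext ω
  simp only [Set.mem_ofPred_eq, Set.mem_union]
  constructor
  · intro h
    have key : ∀ b : ℝ, (-1 : ℝ) ^ N (a 0) ω = b * s 0 →
        ∀ k ≤ m, (-1 : ℝ) ^ N (a k) ω = b * s k := by
      intro b hb k
      induction k with
      | zero => exact fun _ ↦ hb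
      | succ k ih =>
        intro hk
        have h1 := ih (by omega)
        have h2 := h k (by omega)
        rw [hsub] at h2
        calc (-1 : ℝ) ^ N (a (k + 1)) ω
            = (-1 : ℝ) ^ N (a k) ω * ((-1 : ℝ) ^ N (a k) ω * (-1 : ℝ) ^ N (a (k + 1)) ω) := by
              rw [← mul_assoc, hsq, one_mul]
          _ = b * s k * (s k * s (k + 1)) := by rw [h2, h1]
          _ = b * s (k + 1) := by linear_combination b * s (k + 1) * hss k
    have h0 : (-1 : ℝ) ^ N (a 0) ω = 1 * s 0 ∨ (-1 : ℝ) ^ N (a 0) ω = -1 * s 0 := by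
      rcases Int.even_or_odd (N (a 0) ω) with hx | hx <;> rcases hs 0 with h | h <;>
        simp [hx.neg_one_zpow, h]
    rcases h0 with h0 | h0
    · exact Or.inl fun k hk ↦ by simpa using key 1 h0 k hk
    · exact Or.inr fun k hk ↦ by simpa using key (-1) h0 k hk
  · rintro (h | h) k hk <;> rw [hsub, h k hk.le, h (k + 1) hk]
    ring

theorem ae_eq_one_or_neg_one [IsProbabilityMeasure P] (hB : Measurable B)
    (hB_pos : P {ω | B ω = 1} = 1 / 2) (hB_neg : P {ω | B ω = -1} = 1 / 2) :
    ∀ᵐ ω ∂P, B ω = 1 ∨ B ω = -1 := by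
  have hone : (1 : ℝ) ≠ -1 := by norm_num
  have hBp : MeasurableSet {ω | B ω = 1} := hB (measurableSet_singleton _)
  have hBn : MeasurableSet {ω | B ω = -1} := hB (measurableSet_singleton _)
  have hd : Disjoint {ω | B ω = 1} {ω | B ω = -1} := by
    rw [Set.disjoint_left]
    exact fun ω (h : B ω = 1) (h' : B ω = -1) ↦ hone (h.symm.trans h')
  have : P ({ω | B ω = 1} ∪ {ω | B ω = -1}) = 1 := by
    rw [measure_union hd hBn, hB_pos, hB_neg]
    exact ENNReal.add_halves 1
  exact (prob_compl_eq_zero_iff (hBp.union hBn)).2 this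

/-- The finite-dimensional distributions of the jump process. -/
theorem measureReal_jumpProcess [IsProbabilityMeasure P]
    (hN : IsTwoSidedPoissonProcess N P) (hB : Measurable B)
    (hB_pos : P {ω | B ω = 1} = 1 / 2) (hB_neg : P {ω | B ω = -1} = 1 / 2)
    (hBN : IndepFun B (fun ω t ↦ N t ω) P) {a : ℕ → ℝ} (ha : Monotone a) {s : ℕ → ℝ}
    (hs : ∀ k, s k = 1 ∨ s k = -1) (m : ℕ) :
    P.real {ω | ∀ k ≤ m, jumpProcess B N (a k) ω = s k}
      = 1 / 2 * ∏ k ∈ Finset.range m,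
        (1 + s k * s (k + 1) * Real.exp (-2 * (a (k + 1) - a k))) / 2 := by
  have hprod : ∀ k, s k * s (k + 1) = 1 ∨ s k * s (k + 1) = -1 := fun k ↦ by
    rcases hs k with h | h <;> rcases hs (k + 1) with h' | h' <;> simp [h, h']
  rw [← hN.measureReal_parities ha hprod, setOf_parities_eq_union hs]
  have hmeasF : ∀ s' : ℕ → ℝ, MeasurableSet {f : ℝ → ℤ | ∀ k ≤ m, (-1 : ℝ) ^ f (a k) = s' k} := by
    intro s'
    simp only [Set.ofPred_forall]
    refine MeasurableSet.iInter fun k ↦ MeasurableSet.iInter fun _ ↦ ?_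
    exact (measurable_from_top (f := fun z : ℤ ↦ (-1 : ℝ) ^ z)).comp (measurable_pi_apply (a k))
      (measurableSet_singleton _)
  have hNm : Measurable (fun ω t ↦ N t ω) := measurable_pi_lambda _ hN.measurable
  have hmeas : ∀ s' : ℕ → ℝ, MeasurableSet {ω | ∀ k ≤ m, (-1 : ℝ) ^ N (a k) ω = s' k} :=
    fun s' ↦ hNm (hmeasF s')
  have hone : (1 : ℝ) ≠ -1 := by norm_num
  have hdisj : Disjoint {ω | ∀ k ≤ m, (-1 : ℝ) ^ N (a k) ω = s k}
      {ω | ∀ k ≤ m, (-1 : ℝ) ^ N (a k) ω = -s k} := by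
    rw [Set.disjoint_left]
    intro ω h h'
    have := (h 0 m.zero_le).symm.trans (h' 0 m.zero_le)
    rcases hs 0 with h0 | h0 <;> rw [h0] at this <;> norm_num at this
  have hBn : MeasurableSet {ω | B ω = -1} := hB (measurableSet_singleton _)
  have hind : ∀ (b : ℝ) (s' : ℕ → ℝ), P {ω | B ω = b} = 1 / 2 →
      P.real ({ω | B ω = b} ∩ {ω | ∀ k ≤ m, (-1 : ℝ) ^ N (a k) ω = s' k})
        = 1 / 2 * P.real {ω | ∀ k ≤ m, (-1 : ℝ) ^ N (a k) ω = s' k} := by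
    intro b s' hb
    have := hBN.measure_inter_preimage_eq_mul {b} _ (measurableSet_singleton b) (hmeasF s')
    have h2 : P ({ω | B ω = b} ∩ {ω | ∀ k ≤ m, (-1 : ℝ) ^ N (a k) ω = s' k})
        = P {ω | B ω = b} * P {ω | ∀ k ≤ m, (-1 : ℝ) ^ N (a k) ω = s' k} := this
    rw [measureReal_def, h2, hb, ENNReal.toReal_mul, measureReal_def]
    simp
  have hBdisj : Disjoint ({ω | B ω = 1} ∩ {ω | ∀ k ≤ m, (-1 : ℝ) ^ N (a k) ω = s k})
      ({ω | B ω = -1} ∩ {ω | ∀ k ≤ m, (-1 : ℝ) ^ N (a k) ω = -s k}) :=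
    hdisj.mono Set.inter_subset_right Set.inter_subset_right
  have hae := ae_eq_one_or_neg_one hB hB_pos hB_neg
  -- The two values of `B` select the two halves of the parity event, each with weight `1 / 2`. The
  -- halves thus recombine, and only the probability of their union, known from the increments, is
  -- needed.
  have hev : ({ω | ∀ k ≤ m, jumpProcess B N (a k) ω = s k} : Set Ω) =ᵐ[P]
      (({ω | B ω = 1} ∩ {ω | ∀ k ≤ m, (-1 : ℝ) ^ N (a k) ω = s k}) ∪
      ({ω | B ω = -1} ∩ {ω | ∀ k ≤ m, (-1 : ℝ) ^ N (a k) ω = -s k}) : Set Ω) := by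
    refine Filter.eventuallyEq_set.2 ?_
    filter_upwards [hae] with ω hω
    rcases hω with h | h
    · simp [jumpProcess, h, hone]
    · simp [jumpProcess, h, hone.symm, neg_eq_iff_eq_neg]
  rw [measureReal_congr hev, measureReal_union hBdisj (hBn.inter (hmeas _)),
    measureReal_union hdisj (hmeas _), hind 1 s hB_pos, hind (-1) (fun k ↦ -s k) hB_neg]
  ring

/-- The process almost surely does not jump at a fixed time. -/
theorem ae_continuousAt [IsProbabilityMeasure P] (hN : IsTwoSidedPoissonProcess N P) (t : ℝ) :
    ∀ᵐ ω ∂P, ContinuousAt (fun s ↦ N s ω) t := by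
  -- A jump at `t` from the left makes every increment over `[t - 1 / (j + 1), t]` nonzero. A single
  -- such increment is nonzero with probability `1 - exp (-1 / (k + 1))`, which tends to `0`.
  have hbound : ∀ k : ℕ, P.real {ω | ∀ j : ℕ, N t ω - N (t - 1 / ((j : ℝ) + 1)) ω ≠ 0}
      ≤ 1 - Real.exp (-(1 / ((k : ℝ) + 1))) := by
    intro k
    have hk : (0 : ℝ) < 1 / ((k : ℝ) + 1) := by positivity
    have hlaw := hN.law_increment (t - 1 / ((k : ℝ) + 1)) t (by linarith)
    have h0 : P.real {ω | N t ω - N (t - 1 / ((k : ℝ) + 1)) ω = 0}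
        = Real.exp (-(1 / ((k : ℝ) + 1))) := by
      rw [measureReal_def, hlaw.measure_eq (p := fun z ↦ z = 0) MeasurableSet.of_discrete,
        Measure.map_apply measurable_from_top MeasurableSet.of_discrete]
      have hpre : (fun k : ℕ ↦ (k : ℤ)) ⁻¹' {x | x = 0} = {0} := by ext; simp
      rw [hpre, ← measureReal_def, poissonMeasure_real_singleton, Real.coe_toNNReal _ (by linarith)]
      simp
    have hm : MeasurableSet {ω | N t ω - N (t - 1 / ((k : ℝ) + 1)) ω = 0} :=
      ((hN.measurable t).sub (hN.measurable _)) (measurableSet_singleton 0)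
    calc _ ≤ P.real {ω | N t ω - N (t - 1 / ((k : ℝ) + 1)) ω = 0}ᶜ :=
          measureReal_mono (Set.ofPred_subset_ofPred.2 fun ω h ↦ h k)
      _ = _ := by rw [probReal_compl_eq_one_sub hm, h0]
  have hlim : Tendsto (fun k : ℕ ↦ 1 - Real.exp (-(1 / ((k : ℝ) + 1)))) atTop (𝓝 0) := by
    have := (Real.continuous_exp.tendsto _).comp
      (tendsto_one_div_add_atTop_nhds_zero_nat (𝕜 := ℝ)).neg
    simpa using this.const_sub 1
  have hzero : P.real {ω | ∀ j : ℕ, N t ω - N (t - 1 / ((j : ℝ) + 1)) ω ≠ 0} = 0 :=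
    le_antisymm (ge_of_tendsto' hlim hbound) measureReal_nonneg
  have hae : ∀ᵐ ω ∂P, ¬ ∀ j : ℕ, N t ω - N (t - 1 / ((j : ℝ) + 1)) ω ≠ 0 := by
    rw [ae_iff]
    simpa using (measureReal_eq_zero_iff).1 hzero
  filter_upwards [hae, hN.paths] with ω hω ⟨hmono, hright⟩
  push Not at hω
  obtain ⟨j, hj⟩ := hω
  have hjp : (0 : ℝ) < 1 / ((j : ℝ) + 1) := by positivity
  rw [continuousAt_iff_continuous_left'_right']
  refine ⟨?_, (hright t).mono Set.Ioi_subset_Ici_self⟩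
  -- One vanishing increment, with monotonicity, makes the path constant just to the left of `t`.
  refine (tendsto_const_nhds (x := N t ω)).congr' ?_
  filter_upwards [Ioo_mem_nhdsLT (show t - 1 / ((j : ℝ) + 1) < t by linarith)] with s hs
  have h1 : N (t - 1 / ((j : ℝ) + 1)) ω ≤ N s ω := hmono hs.1.le
  have h2 : N s ω ≤ N t ω := hmono hs.2.le
  omega

end IsTwoSidedPoissonProcess

end Poisson

/-! ### The Ising energy as a sum over ordered pairs, and configurations read off functions -/

theorem spin_eq_one_or_neg_one {L : ℕ} (σ : Config L) (i : ℤ) :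
    spin σ i = 1 ∨ spin σ i = -1 := by
  unfold spin
  split_ifs with h
  · rcases Int.units_eq_one_or (σ ⟨i, h⟩) with h' | h' <;> simp [h']
  · exact Or.inl rfl

/-- Only two-element sets contribute, and each comes from exactly two ordered pairs, whence the
factor `1 / 2`. -/
theorem neg_isingEnergy_pairInteraction (w : ℕ → ℝ) (L : ℕ) (σ : Config L) :
    -isingEnergy (pairInteraction w) L σ = 1 / 2 * ∑ i ∈ lattice L, ∑ j ∈ lattice L,
      if i = j then 0 else w (i - j).natAbs * (spin σ i * spin σ j) := by
  have hfib : ∑ p ∈ (lattice L).offDiag, w (p.1 - p.2).natAbs * (spin σ p.1 * spin σ p.2)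
      = ∑ A ∈ (lattice L).powersetCard 2, ∑ p ∈ (lattice L).offDiag with {p.1, p.2} = A,
        w (p.1 - p.2).natAbs * (spin σ p.1 * spin σ p.2) := by
    refine (Finset.sum_fiberwise_of_maps_to (fun p hp ↦ ?_) _).symm
    rw [Finset.mem_offDiag] at hp
    rw [Finset.mem_powersetCard]
    refine ⟨?_, Finset.card_pair hp.2.2⟩
    simp [Finset.insert_subset_iff, hp.1, hp.2.1]
  have hpair : ∀ A ∈ (lattice L).powersetCard 2,
      ∑ p ∈ (lattice L).offDiag with {p.1, p.2} = A,
        w (p.1 - p.2).natAbs * (spin σ p.1 * spin σ p.2)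
      = 2 * (pairInteraction w A * ∏ i ∈ A, spin σ i) := by
    intro A hA
    obtain ⟨hsub, hcard⟩ := Finset.mem_powersetCard.1 hA
    obtain ⟨x, y, hxy, rfl⟩ := Finset.card_eq_two.1 hcard
    have hx : x ∈ lattice L := hsub (by simp)
    have hy : y ∈ lattice L := hsub (by simp)
    have hfilter : {p ∈ (lattice L).offDiag | ({p.1, p.2} : Finset ℤ) = {x, y}}
        = {(x, y), (y, x)} := by
      ext ⟨a, b⟩
      simp only [Finset.mem_filter, Finset.mem_offDiag, Finset.mem_insert, Finset.mem_singleton,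
        Prod.mk.injEq]
      constructor
      · rintro ⟨⟨_, _, hab⟩, h⟩
        have ha : a ∈ ({x, y} : Finset ℤ) := h ▸ by simp
        have hb : b ∈ ({x, y} : Finset ℤ) := h ▸ by simp
        simp only [Finset.mem_insert, Finset.mem_singleton] at ha hb
        omega
      · rintro (⟨rfl, rfl⟩ | ⟨rfl, rfl⟩)
        · exact ⟨⟨hx, hy, hxy⟩, rfl⟩
        · exact ⟨⟨hy, hx, hxy.symm⟩, Finset.pair_comm _ _⟩
    have hne : (x, y) ≠ (y, x) := fun h ↦ hxy (Prod.mk.inj h).1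
    rw [hfilter, Finset.sum_pair hne, Finset.prod_pair hxy, pairInteraction_pair w hxy,
      ← neg_sub x y, Int.natAbs_neg]
    ring
  have hoff : ∑ i ∈ lattice L, ∑ j ∈ lattice L,
      (if i = j then 0 else w (i - j).natAbs * (spin σ i * spin σ j))
      = ∑ p ∈ (lattice L).offDiag, w (p.1 - p.2).natAbs * (spin σ p.1 * spin σ p.2) := by
    have hset : (lattice L).offDiag
        = (lattice L ×ˢ lattice L).filter fun p ↦ ¬ p.1 = p.2 := by
      ext p
      simp [Finset.mem_offDiag, and_assoc]
    rw [← Finset.sum_product', hset, Finset.sum_filter]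
    simp_rw [ite_not]
  have hpow : ∑ A ∈ (lattice L).powerset, pairInteraction w A * ∏ i ∈ A, spin σ i
      = ∑ A ∈ (lattice L).powersetCard 2, pairInteraction w A * ∏ i ∈ A, spin σ i := by
    refine (Finset.sum_subset (fun A hA ↦ ?_) fun A hA hA' ↦ ?_).symm
    · exact Finset.mem_powerset.2 (Finset.mem_powersetCard.1 hA).1
    · rw [pairInteraction_of_card_ne, zero_mul]
      exact fun h ↦ hA' (Finset.mem_powersetCard.2 ⟨Finset.mem_powerset.1 hA, h⟩)
  rw [hoff, hfib, Finset.sum_congr rfl hpair, ← Finset.mul_sum, isingEnergy, hpow]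
  ring

/-- The sum `∑_{i ≠ j} δ² W(δ (i - j)) x_i x_j` over the ordered pairs of sites of the lattice. -/
noncomputable def longRangeSum (W : ℝ → ℝ) (δ : ℝ) (L : ℕ) (x : ℤ → ℝ) : ℝ :=
  ∑ i ∈ lattice L, ∑ j ∈ lattice L,
    if i = j then 0 else δ ^ 2 * W (δ * (i - j)) * (x i * x j)

theorem sum_lattice_succ (L : ℕ) (g : ℤ → ℝ) :
    ∑ i ∈ lattice L, (if i + 1 ∈ lattice L then g i else 0)
      = ∑ k ∈ Finset.range (2 * L), g (k - L) := by
  rw [← Finset.sum_filter]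
  symm
  refine Finset.sum_bij (fun k _ ↦ (k : ℤ) - L) (fun k hk ↦ ?_) (fun a _ b _ h ↦ ?_)
    (fun i hi ↦ ?_) (fun _ _ ↦ rfl)
  · simp only [lattice, Finset.mem_filter, Finset.mem_Icc, Finset.mem_range] at hk ⊢
    omega
  · omega
  · simp only [lattice, Finset.mem_filter, Finset.mem_Icc] at hi
    exact ⟨(i + L).toNat, by rw [Finset.mem_range]; omega, by omega⟩

theorem sum_neighbours (L : ℕ) (x : ℤ → ℝ) :
    ∑ i ∈ lattice L, ∑ j ∈ lattice L, (if (i - j).natAbs = 1 then x i * x j else 0)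
      = 2 * ∑ k ∈ Finset.range (2 * L), x (k - L) * x (k + 1 - L) := by
  have hone : ∑ i ∈ lattice L, ∑ j ∈ lattice L, (if i + 1 = j then x i * x j else 0)
      = ∑ k ∈ Finset.range (2 * L), x (k - L) * x (k + 1 - L) := by
    simp_rw [Finset.sum_ite_eq]
    rw [sum_lattice_succ L fun i ↦ x i * x (i + 1)]
    refine Finset.sum_congr rfl fun k _ ↦ ?_
    rw [show (k : ℤ) - L + 1 = k + 1 - L by ring]
  have htwo : ∑ i ∈ lattice L, ∑ j ∈ lattice L, (if j + 1 = i then x i * x j else 0)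
      = ∑ k ∈ Finset.range (2 * L), x (k - L) * x (k + 1 - L) := by
    rw [Finset.sum_comm, ← hone]
    simp_rw [mul_comm]
  rw [two_mul]
  nth_rw 1 [← hone]
  rw [← htwo, ← Finset.sum_add_distrib]
  refine Finset.sum_congr rfl fun i _ ↦ ?_
  rw [← Finset.sum_add_distrib]
  refine Finset.sum_congr rfl fun j _ ↦ ?_
  split_ifs <;> first | omega | simp

/-- The `1 / 2` from ordered pairs cancels the doubled long-range coupling, and also the two
orientations of each bond. Evenness of `W` replaces `|i - j|` by `i - j`. -/
theorem neg_isingEnergy_scaledInteraction {W : ℝ → ℝ} (hW : Function.Even W) (δ : ℝ) (L : ℕ)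
    (σ : Config L) :
    -isingEnergy (scaledInteraction W δ) L σ
      = nnCoupling δ * ∑ k ∈ Finset.range (2 * L), spin σ (k - L) * spin σ (k + 1 - L)
        + longRangeSum W δ L (spin σ) := by
  have hWabs : ∀ i j : ℤ, W (δ * ((i - j).natAbs : ℝ)) = W (δ * (i - j)) := by
    intro i j
    have h : ((i - j).natAbs : ℝ) = |(i : ℝ) - j| := by
      rw [Nat.cast_natAbs]
      push_cast
      rfl
    rw [h]
    rcases abs_choice ((i : ℝ) - j) with h | h <;> rw [h]
    rw [mul_neg, hW]
  rw [scaledInteraction, neg_isingEnergy_pairInteraction, ← mul_right_inj' (two_ne_zero (α := ℝ)),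
    mul_add, mul_left_comm _ (nnCoupling δ), ← sum_neighbours, ← mul_assoc, mul_one_div_cancel two_ne_zero,
    one_mul,
    longRangeSum]
  simp_rw [Finset.mul_sum, ← Finset.sum_add_distrib]
  refine Finset.sum_congr rfl fun i _ ↦ Finset.sum_congr rfl fun j _ ↦ ?_
  by_cases hij : i = j
  · simp [hij]
  · by_cases h1 : (i - j).natAbs = 1
    · simp only [hij, h1, if_false, if_true, longRangeCoupling]
      rw [← hWabs, h1]
      ring
    · simp only [hij, h1, if_false, longRangeCoupling]
      rw [← hWabs]
      ring

/-- The configuration on the lattice given by the values of a `±1`-valued function. -/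
noncomputable def configOf (L : ℕ) (x : ℤ → ℝ) : Config L := fun i ↦ if x i = 1 then 1 else -1

theorem spin_configOf {L : ℕ} {x : ℤ → ℝ} {i : ℤ} (hi : i ∈ lattice L) (hx : x i = 1 ∨ x i = -1) :
    spin (configOf L x) i = x i := by
  rw [spin, dif_pos hi, configOf]
  rcases hx with h | h
  · simp [h]
  · norm_num [h]

/-- Indexing the sites as `k - L` with `k ≤ 2 * L` matches the time grids indexed by `ℕ` in the
finite-dimensional laws. -/
theorem configOf_eq_iff {L : ℕ} {x : ℤ → ℝ} (hx : ∀ i, x i = 1 ∨ x i = -1) (σ : Config L) :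
    configOf L x = σ ↔ ∀ k ≤ 2 * L, x (k - L) = spin σ (k - L) := by
  constructor
  · rintro rfl k hk
    refine (spin_configOf ?_ (hx _)).symm
    rw [lattice, Finset.mem_Icc]
    omega
  · intro h
    ext ⟨i, hi⟩
    have hi' := hi
    rw [lattice, Finset.mem_Icc] at hi'
    have h1 := h (i + L).toNat (by omega)
    rw [show ((i + L).toNat : ℤ) - L = i by omega, spin, dif_pos hi] at h1
    rw [configOf]
    simp only [h1]
    rcases Int.units_eq_one_or (σ ⟨i, hi⟩) with h' | h' <;> norm_num [h']

theorem longRangeSum_congr {W : ℝ → ℝ} {δ : ℝ} {L : ℕ} {x y : ℤ → ℝ}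
    (h : ∀ i ∈ lattice L, x i = y i) : longRangeSum W δ L x = longRangeSum W δ L y :=
  Finset.sum_congr rfl fun i hi ↦ Finset.sum_congr rfl fun j hj ↦ by rw [h i hi, h j hj]

/-! ### The sampled jump process as an Ising chain -/

theorem exp_neg_two_mul_artanh {δ : ℝ} (hδ : δ ∈ Set.Ioo (0 : ℝ) 1) :
    Real.exp (-2 * Real.artanh δ) = (1 - δ) / (1 + δ) := by
  have h1 : 0 < 1 - δ := by linarith [hδ.2]
  have h2 : 0 < 1 + δ := by linarith [hδ.1]
  rw [show -2 * Real.artanh δ = -(Real.artanh δ + Real.artanh δ) by ring, Real.exp_neg,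
    Real.exp_add, Real.exp_artanh ⟨by linarith [hδ.1], hδ.2⟩, Real.mul_self_sqrt (by positivity),
    inv_div]

/-- This is where the step `artanh δ` comes from: it makes the transition probability proportional
to `exp (j_δ c)`. The normalisation `exp (j_δ) (1 + δ)` equals `exp (j_δ) + exp (-j_δ)`. -/
theorem flip_weight {δ : ℝ} (hδ : δ ∈ Set.Ioo (0 : ℝ) 1) {c : ℝ} (hc : c = 1 ∨ c = -1) :
    (1 + c * Real.exp (-2 * Real.artanh δ)) / 2
      = (Real.exp (nnCoupling δ) * (1 + δ))⁻¹ * Real.exp (nnCoupling δ * c) := by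
  have h0 : 0 < δ := hδ.1
  have h2 : 0 < 1 + δ := by linarith
  have he := Real.exp_pos (nnCoupling δ)
  rw [exp_neg_two_mul_artanh hδ]
  rcases hc with rfl | rfl
  · rw [mul_one]
    field_simp
    ring
  · have hsq : Real.exp (nnCoupling δ) * Real.exp (nnCoupling δ) = δ⁻¹ := by
      rw [← Real.exp_add, nnCoupling, ← Real.exp_log (inv_pos.2 h0), Real.log_inv]
      congr 1
      ring
    rw [mul_neg_one, Real.exp_neg, mul_inv, mul_right_comm, ← mul_inv, hsq, inv_inv]
    field_simp
    ring

section IsingChain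

variable {Ω : Type*} [MeasurableSpace Ω] {P : Measure Ω} {N : ℝ → Ω → ℤ} {B : Ω → ℝ}

theorem jumpProcess_eq_one_or_neg_one {Ω : Type*} {N : ℝ → Ω → ℤ} {B : Ω → ℝ}
    {ω : Ω} (h : B ω = 1 ∨ B ω = -1) (t : ℝ) :
    jumpProcess B N t ω = 1 ∨ jumpProcess B N t ω = -1 := by
  rw [jumpProcess]
  rcases Int.even_or_odd (N t ω) with hx | hx <;> rcases h with h | h <;>
    simp [hx.neg_one_zpow, h]

theorem measurable_jumpProcess (hB : Measurable B) (hN : IsTwoSidedPoissonProcess N P) (t : ℝ) :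
    Measurable (jumpProcess B N t) :=
  hB.mul ((measurable_from_top (f := fun z : ℤ ↦ (-1 : ℝ) ^ z)).comp (hN.measurable t))

theorem measurableSingletonClass_config (L : ℕ) : MeasurableSingletonClass (Config L) := by
  have : MeasurableSingletonClass ℤˣ :=
    ⟨fun x ↦ ⟨{(x : ℤ)}, measurableSet_singleton _, by ext; simp [Units.ext_iff]⟩⟩
  infer_instance

theorem measurable_configOf_jumpProcess (hB : Measurable B) (hN : IsTwoSidedPoissonProcess N P)
    (h : ℝ) (L : ℕ) : Measurable fun ω ↦ configOf L fun i ↦ jumpProcess B N (h * i) ω := by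
  refine measurable_pi_lambda _ fun i ↦ ?_
  exact Measurable.ite (measurable_jumpProcess hB hN _ (measurableSet_singleton 1))
    measurable_const measurable_const

/-- The jump process observed with step `artanh δ` is the nearest-neighbour Ising chain. -/
theorem measureReal_configOf_jumpProcess [IsProbabilityMeasure P]
    (hN : IsTwoSidedPoissonProcess N P) (hB : Measurable B)
    (hB_pos : P {ω | B ω = 1} = 1 / 2) (hB_neg : P {ω | B ω = -1} = 1 / 2)
    (hBN : IndepFun B (fun ω t ↦ N t ω) P) {δ : ℝ} (hδ : δ ∈ Set.Ioo (0 : ℝ) 1) (L : ℕ)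
    (σ : Config L) :
    P.real {ω | configOf L (fun i ↦ jumpProcess B N (Real.artanh δ * i) ω) = σ}
      = 1 / 2 * (Real.exp (nnCoupling δ) * (1 + δ))⁻¹ ^ (2 * L) * Real.exp (nnCoupling δ *
        ∑ k ∈ Finset.range (2 * L), spin σ (k - L) * spin σ (k + 1 - L)) := by
  have hpos : 0 < Real.artanh δ := Real.artanh_pos hδ
  have hmono : Monotone fun k : ℕ ↦ Real.artanh δ * (((k : ℤ) - L : ℤ) : ℝ) := by
    intro a b hab
    have : (a : ℝ) ≤ b := by exact_mod_cast hab
    simp only [Int.cast_sub, Int.cast_natCast]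
    gcongr
  have hlaw := hN.measureReal_jumpProcess hB hB_pos hB_neg hBN hmono
    (fun k ↦ spin_eq_one_or_neg_one σ (k - L)) (2 * L)
  have hev : ({ω | configOf L (fun i ↦ jumpProcess B N (Real.artanh δ * i) ω) = σ} : Set Ω) =ᵐ[P]
      ({ω | ∀ k ≤ 2 * L, jumpProcess B N (Real.artanh δ * (((k : ℤ) - L : ℤ) : ℝ)) ω
        = spin σ (k - L)} : Set Ω) := by
    refine Filter.eventuallyEq_set.2 ?_
    filter_upwards [IsTwoSidedPoissonProcess.ae_eq_one_or_neg_one hB hB_pos hB_neg] with ω hω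
    exact configOf_eq_iff (fun i ↦ jumpProcess_eq_one_or_neg_one hω _) σ
  rw [measureReal_congr hev, hlaw, Finset.mul_sum, Real.exp_sum, mul_assoc]
  congr 1
  -- The normalising power is spread over the `2 * L` bonds, so that the two products can be
  -- compared factor by factor.
  nth_rw 2 [← Finset.card_range (2 * L)]
  rw [← Finset.prod_const, ← Finset.prod_mul_distrib]
  refine Finset.prod_congr rfl fun k _ ↦ ?_
  rw [show Real.artanh δ * ((((k + 1 : ℕ) : ℤ) - L : ℤ) : ℝ)
    - Real.artanh δ * (((k : ℤ) - L : ℤ) : ℝ) = Real.artanh δ by push_cast; ring, flip_weight hδ]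
  · push_cast
    rfl
  · rcases spin_eq_one_or_neg_one σ (k - L) with h | h <;>
      rcases spin_eq_one_or_neg_one σ ((k + 1 : ℕ) - L) with h' | h' <;> simp only [h, h'] <;>
      norm_num

/-- The nearest-neighbour weight is, up to a constant, the law of the sampled configuration; the
rest of the summand is a function of that configuration. The constant does not depend on `f`, so it
cancels in Gibbs expectations. -/
theorem sum_config_eq_integral [IsProbabilityMeasure P]
    (hN : IsTwoSidedPoissonProcess N P) (hB : Measurable B)
    (hB_pos : P {ω | B ω = 1} = 1 / 2) (hB_neg : P {ω | B ω = -1} = 1 / 2)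
    (hBN : IndepFun B (fun ω t ↦ N t ω) P) {W : ℝ → ℝ} (hW : Function.Even W) {δ : ℝ}
    (hδ : δ ∈ Set.Ioo (0 : ℝ) 1) (L : ℕ) (f : Config L → ℝ) :
    ∑ σ : Config L, f σ * Real.exp (-isingEnergy (scaledInteraction W δ) L σ)
      = 2 * (Real.exp (nnCoupling δ) * (1 + δ)) ^ (2 * L) *
        ∫ ω, f (configOf L fun i ↦ jumpProcess B N (Real.artanh δ * i) ω) *
          Real.exp (longRangeSum W δ L fun i ↦ jumpProcess B N (Real.artanh δ * i) ω) ∂P := by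
  have := measurableSingletonClass_config L
  set Y : Ω → Config L := fun ω ↦ configOf L fun i ↦ jumpProcess B N (Real.artanh δ * i) ω with hY
  have hYm : Measurable Y := measurable_configOf_jumpProcess hB hN _ L
  have hspin : ∀ᵐ ω ∂P, longRangeSum W δ L (spin (Y ω))
      = longRangeSum W δ L fun i ↦ jumpProcess B N (Real.artanh δ * i) ω := by
    filter_upwards [IsTwoSidedPoissonProcess.ae_eq_one_or_neg_one hB hB_pos hB_neg] with ω hω
    exact longRangeSum_congr fun i hi ↦
      spin_configOf (x := fun i : ℤ ↦ jumpProcess B N (Real.artanh δ * i) ω) hi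
        (jumpProcess_eq_one_or_neg_one hω _)
  have hint : ∫ ω, f (Y ω) * Real.exp (longRangeSum W δ L fun i ↦
      jumpProcess B N (Real.artanh δ * i) ω) ∂P
      = ∑ σ : Config L, P.real {ω | Y ω = σ} * (f σ * Real.exp (longRangeSum W δ L (spin σ))) := by
    rw [integral_congr_ae (g := fun ω ↦ f (Y ω) * Real.exp (longRangeSum W δ L (spin (Y ω))))
      (by filter_upwards [hspin] with ω hω; rw [hω])]
    have := Measure.isProbabilityMeasure_map (μ := P) hYm.aemeasurable
    rw [← integral_map (f := fun σ ↦ f σ * Real.exp (longRangeSum W δ L (spin σ)))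
      hYm.aemeasurable (measurable_of_finite _).aestronglyMeasurable,
      integral_fintype Integrable.of_finite]
    refine Finset.sum_congr rfl fun σ _ ↦ ?_
    rw [map_measureReal_apply hYm (measurableSet_singleton σ), smul_eq_mul]
    rfl
  have hκ : Real.exp (nnCoupling δ) * (1 + δ) ≠ 0 :=
    (mul_pos (Real.exp_pos _) (by linarith [hδ.1])).ne'
  rw [hint, Finset.mul_sum]
  refine Finset.sum_congr rfl fun σ _ ↦ ?_
  rw [hY, measureReal_configOf_jumpProcess hN hB hB_pos hB_neg hBN hδ,
    neg_isingEnergy_scaledInteraction hW, Real.exp_add, inv_pow]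
  field_simp

/-- The lattice correlations are correlations of the jump process at times spaced by
`artanh δ`. -/
theorem latticeCorrelation_eq [IsProbabilityMeasure P]
    (hN : IsTwoSidedPoissonProcess N P) (hB : Measurable B)
    (hB_pos : P {ω | B ω = 1} = 1 / 2) (hB_neg : P {ω | B ω = -1} = 1 / 2)
    (hBN : IndepFun B (fun ω t ↦ N t ω) P) {W : ℝ → ℝ} (hW : Function.Even W) {T δ : ℝ}
    (hδ : δ ∈ Set.Ioo (0 : ℝ) 1) {n : ℕ} {t : Fin n → ℝ} (ht : ∀ k, t k ∈ Set.Icc (-T) T) :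
    latticeCorrelation W T δ t
      = (∫ ω, Real.exp (longRangeSum W δ (latticeSize δ T)
          fun i ↦ jumpProcess B N (Real.artanh δ * i) ω) ∂P)⁻¹ *
        ∫ ω, (∏ k, jumpProcess B N (Real.artanh δ * site δ (t k)) ω) *
          Real.exp (longRangeSum W δ (latticeSize δ T)
            fun i ↦ jumpProcess B N (Real.artanh δ * i) ω) ∂P := by
  have hκ : 2 * (Real.exp (nnCoupling δ) * (1 + δ)) ^ (2 * latticeSize δ T) ≠ 0 := by
    have : 0 < 1 + δ := by linarith [hδ.1]
    positivity
  have hZ := sum_config_eq_integral hN hB hB_pos hB_neg hBN hW hδ (latticeSize δ T) fun _ ↦ 1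
  simp only [one_mul] at hZ
  -- Times in `[-T, T]` have their sites in the lattice, so the default value `1` of `spin` never
  -- enters.
  have hprod : ∀ᵐ ω ∂P, (∏ k, spin (configOf (latticeSize δ T)
      fun i ↦ jumpProcess B N (Real.artanh δ * i) ω) (site δ (t k)))
      = ∏ k, jumpProcess B N (Real.artanh δ * site δ (t k)) ω := by
    filter_upwards [IsTwoSidedPoissonProcess.ae_eq_one_or_neg_one hB hB_pos hB_neg] with ω hω
    exact Finset.prod_congr rfl fun k _ ↦
      spin_configOf (x := fun i : ℤ ↦ jumpProcess B N (Real.artanh δ * i) ω)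
        (site_mem_lattice hδ.1 (ht k)) (jumpProcess_eq_one_or_neg_one hω _)
  rw [latticeCorrelation, isingExpectation, isingPartition, hZ,
    sum_config_eq_integral hN hB hB_pos hB_neg hBN hW hδ, mul_inv, mul_mul_mul_comm,
    inv_mul_cancel₀ hκ, one_mul]
  congr 1
  refine integral_congr_ae ?_
  filter_upwards [hprod] with ω hω
  rw [hω]

end IsingChain

/-! ### Scaled sites and Riemann sums along a path -/

theorem eventually_mem_Ioo_zero_one : ∀ᶠ δ : ℝ in 𝓝[>] 0, δ ∈ Set.Ioo (0 : ℝ) 1 :=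
  Ioo_mem_nhdsGT one_pos

theorem abs_mul_site_sub_le {δ : ℝ} (hδ : 0 < δ) (s : ℝ) : |δ * site δ s - s| ≤ δ / 2 := by
  have h1 := Int.floor_le (s / δ + 1 / 2)
  have h2 := Int.lt_floor_add_one (s / δ + 1 / 2)
  have h3 : δ * (s / δ) = s := mul_div_cancel₀ s hδ.ne'
  rw [site, abs_le]
  constructor <;> nlinarith

theorem tendsto_mul_site (s : ℝ) : Tendsto (fun δ ↦ δ * site δ s) (𝓝[>] 0) (𝓝 s) := by
  rw [tendsto_iff_norm_sub_tendsto_zero]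
  have hlim : Tendsto (fun δ : ℝ ↦ δ / 2) (𝓝[>] 0) (𝓝 0) := by
    have : Tendsto (fun δ : ℝ ↦ δ / 2) (𝓝 0) (𝓝 (0 / 2)) := tendsto_id.div_const 2
    simpa using this.mono_left nhdsWithin_le_nhds
  refine squeeze_zero' (Eventually.of_forall fun _ ↦ norm_nonneg _) ?_ hlim
  filter_upwards [self_mem_nhdsWithin] with δ hδ
  exact abs_mul_site_sub_le hδ s

/-- The process is sampled with step `artanh δ` while `W` is evaluated on the grid of step `δ`. This
derivative at `0` shows that the mismatch disappears in the limit. -/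
theorem tendsto_artanh_div : Tendsto (fun δ ↦ Real.artanh δ / δ) (𝓝[>] 0) (𝓝 1) := by
  have hlog : ∀ c : ℝ, HasDerivAt (fun x : ℝ ↦ Real.log (1 + c * x)) c 0 := by
    intro c
    have h := (((hasDerivAt_id (0 : ℝ)).const_mul c).const_add 1).log (by simp)
    simpa using h
  have hd : HasDerivAt (fun x : ℝ ↦ 1 / 2 * (Real.log (1 + 1 * x) - Real.log (1 + -1 * x))) 1 0 := by
    have h := ((hlog 1).sub (hlog (-1))).const_mul (1 / 2)
    rw [show (1 / 2 : ℝ) * (1 - -1) = 1 by norm_num] at h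
    exact h
  refine (hd.tendsto_slope_zero_right).congr' ?_
  filter_upwards [eventually_mem_Ioo_zero_one] with δ hδ
  have h1 : 0 < 1 - δ := by linarith [hδ.2]
  have h2 : 0 < 1 + δ := by linarith [hδ.1]
  rw [Real.artanh_eq_half_log ⟨by linarith [hδ.1], hδ.2.le⟩, Real.log_div h2.ne' h1.ne']
  simp
  ring_nf

theorem tendsto_artanh_mul_site (s : ℝ) :
    Tendsto (fun δ ↦ Real.artanh δ * site δ s) (𝓝[>] 0) (𝓝 s) := by
  have h := tendsto_artanh_div.mul (tendsto_mul_site s)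
  rw [one_mul] at h
  refine h.congr' ?_
  filter_upwards [self_mem_nhdsWithin] with δ (hδ : 0 < δ)
  field_simp

theorem measurable_site (δ : ℝ) : Measurable (site δ) :=
  Int.measurable_floor.comp ((measurable_id.div_const δ).add_const (1 / 2))

theorem mul_abs_le_of_mem_lattice {δ T : ℝ} (hδ : 0 < δ) (hT : 0 ≤ T) {i : ℤ}
    (hi : i ∈ lattice (latticeSize δ T)) : |δ * i| ≤ T + δ / 2 := by
  rw [lattice, Finset.mem_Icc] at hi
  have h0 : 0 ≤ T / δ + 1 / 2 := by positivity
  have h1 : (latticeSize δ T : ℝ) ≤ T / δ + 1 / 2 := Nat.floor_le h0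
  have h2 : |(i : ℝ)| ≤ latticeSize δ T := by
    rw [abs_le]
    exact ⟨by exact_mod_cast hi.1, by exact_mod_cast hi.2⟩
  rw [abs_mul, abs_of_pos hδ]
  calc δ * |(i : ℝ)| ≤ δ * (T / δ + 1 / 2) := by gcongr; exact h2.trans h1
    _ = T + δ / 2 := by field_simp

theorem preimage_site_singleton {δ : ℝ} (hδ : 0 < δ) (i : ℤ) :
    site δ ⁻¹' {i} = Set.Ico (δ * (i - 1 / 2)) (δ * (i + 1 / 2)) := by
  ext s
  rw [Set.mem_preimage, Set.mem_singleton_iff, site, Int.floor_eq_iff, Set.mem_Ico,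
    ← le_div_iff₀' hδ, ← div_lt_iff₀' hδ]
  constructor <;> rintro ⟨h1, h2⟩ <;> constructor <;> linarith

/-- Since `site δ` takes the value `i` on an interval of length `δ`, a Riemann sum is exactly the
integral of a step function, to which dominated convergence applies. -/
theorem mul_sum_eq_integral_site {δ : ℝ} (hδ : 0 < δ) (A : Finset ℤ) (F : ℤ → ℝ) :
    δ * ∑ i ∈ A, F i = ∫ s, if site δ s ∈ A then F (site δ s) else 0 := by
  have hpt : (fun s ↦ if site δ s ∈ A then F (site δ s) else 0)
      = fun s ↦ ∑ i ∈ A, (site δ ⁻¹' {i}).indicator (fun _ ↦ F i) s := by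
    ext s
    simp [Set.indicator]
  have hvol : ∀ i : ℤ, volume.real (site δ ⁻¹' {i}) = δ := by
    intro i
    rw [preimage_site_singleton hδ, Real.volume_real_Ico_of_le (by nlinarith)]
    ring
  have hfin : ∀ i : ℤ, volume (site δ ⁻¹' {i}) ≠ ⊤ := by
    intro i
    rw [preimage_site_singleton hδ]
    exact measure_Ico_lt_top.ne
  have hmeas : ∀ i : ℤ, MeasurableSet (site δ ⁻¹' {i}) :=
    fun i ↦ measurable_site δ (measurableSet_singleton i)
  rw [hpt, integral_finsetSum _ fun i _ ↦
    (integrable_indicator_iff (hmeas i)).2 (integrableOn_const (hfin i)), Finset.mul_sum]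
  refine Finset.sum_congr rfl fun i _ ↦ ?_
  rw [integral_indicator_const _ (hmeas i), hvol, smul_eq_mul]

/-- The long-range interaction `W(δ (i - j)) x_i x_j` between different sites `i`, `j` of the
lattice, and `0` otherwise. -/
noncomputable def siteKernel (W : ℝ → ℝ) (T δ : ℝ) (x : ℤ → ℝ) (i j : ℤ) : ℝ :=
  if i ∈ lattice (latticeSize δ T) ∧ j ∈ lattice (latticeSize δ T) ∧ i ≠ j then
    W (δ * (i - j)) * (x i * x j) else 0

theorem longRangeSum_eq_integral (W : ℝ → ℝ) (T : ℝ) {δ : ℝ} (hδ : 0 < δ) (x : ℤ → ℝ) :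
    longRangeSum W δ (latticeSize δ T) x
      = ∫ s, ∫ t, siteKernel W T δ x (site δ s) (site δ t) := by
  have h : longRangeSum W δ (latticeSize δ T) x
      = δ * ∑ i ∈ lattice (latticeSize δ T), δ * ∑ j ∈ lattice (latticeSize δ T),
        if i = j then 0 else W (δ * (i - j)) * (x i * x j) := by
    simp_rw [longRangeSum, Finset.mul_sum]
    refine Finset.sum_congr rfl fun i _ ↦ Finset.sum_congr rfl fun j _ ↦ ?_
    split_ifs <;> ring
  rw [h, mul_sum_eq_integral_site hδ]
  refine integral_congr_ae (Eventually.of_forall fun s ↦ ?_)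
  by_cases hs : site δ s ∈ lattice (latticeSize δ T)
  · simp only [hs, if_true, siteKernel, true_and]
    rw [mul_sum_eq_integral_site hδ]
    refine integral_congr_ae (Eventually.of_forall fun t ↦ ?_)
    by_cases ht : site δ t ∈ lattice (latticeSize δ T) <;>
      by_cases hst : site δ s = site δ t <;> simp [ht, hst]
  · simp [hs, siteKernel]

/-- The bound is a product in `s` and `t`, so it can dominate the inner and the outer integral in
turn. -/
theorem exists_norm_siteKernel_le {W : ℝ → ℝ} (hW : Continuous W) {T : ℝ} (hT : 0 < T) :
    ∃ M : ℝ, ∀ δ ∈ Set.Ioo (0 : ℝ) 1, ∀ x : ℤ → ℝ, (∀ i, |x i| ≤ 1) → ∀ s t : ℝ,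
      ‖siteKernel W T δ x (site δ s) (site δ t)‖
        ≤ (Set.Icc (-(T + 1)) (T + 1)).indicator (fun _ ↦ 1) s *
          (Set.Icc (-(T + 1)) (T + 1)).indicator (fun _ ↦ M) t := by
  -- For `δ < 1`, lattice points satisfy `|δ i| ≤ T + 1 / 2`, so their differences lie in this
  -- interval. A time lies within `δ / 2` of its lattice point, whence `T + 1` below.
  obtain ⟨M, hM⟩ := (isCompact_Icc (a := -(2 * T + 1)) (b := 2 * T + 1)).exists_bound_of_continuousOn
    hW.continuousOn
  have hM0 : 0 ≤ M := (norm_nonneg _).trans (hM 0 ⟨by linarith, by linarith⟩)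
  refine ⟨M, fun δ hδ x hx s t ↦ ?_⟩
  have hmem : ∀ r, site δ r ∈ lattice (latticeSize δ T) → r ∈ Set.Icc (-(T + 1)) (T + 1) := by
    intro r hr
    have h1 := abs_le.1 (mul_abs_le_of_mem_lattice hδ.1 hT.le hr)
    have h2 := abs_le.1 (abs_mul_site_sub_le hδ.1 r)
    have h3 := hδ.2
    exact ⟨by linarith [h1.1, h2.2], by linarith [h1.2, h2.1]⟩
  rw [siteKernel]
  split_ifs with h
  · rw [Set.indicator_of_mem (hmem s h.1), Set.indicator_of_mem (hmem t h.2.1), one_mul, norm_mul,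
      norm_mul]
    have h1 := abs_le.1 (mul_abs_le_of_mem_lattice hδ.1 hT.le h.1)
    have h2 := abs_le.1 (mul_abs_le_of_mem_lattice hδ.1 hT.le h.2.1)
    have h3 := hδ.2
    have hWM := hM (δ * (site δ s - site δ t))
      ⟨by linarith [h1.1, h2.2], by linarith [h1.2, h2.1]⟩
    calc _ ≤ M * (1 * 1) := by gcongr <;> exact hx _
      _ = M := by ring
  · rw [norm_zero]
    exact mul_nonneg (Set.indicator_nonneg (fun _ _ ↦ zero_le_one) _)
      (Set.indicator_nonneg (fun _ _ ↦ hM0) _)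

theorem integrable_indicator_Icc_const (a b M : ℝ) :
    Integrable ((Set.Icc a b).indicator fun _ ↦ M) :=
  (integrable_indicator_iff measurableSet_Icc).2 (integrableOn_const measure_Icc_lt_top.ne)

theorem exists_abs_longRangeSum_le {W : ℝ → ℝ} (hW : Continuous W) {T : ℝ} (hT : 0 < T) :
    ∃ C : ℝ, ∀ δ ∈ Set.Ioo (0 : ℝ) 1, ∀ x : ℤ → ℝ, (∀ i, |x i| ≤ 1) →
      |longRangeSum W δ (latticeSize δ T) x| ≤ C := by
  obtain ⟨M, hM⟩ := exists_norm_siteKernel_le hW hT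
  set I := Set.Icc (-(T + 1)) (T + 1)
  refine ⟨∫ s, I.indicator (fun _ ↦ 1) s * ∫ t, I.indicator (fun _ ↦ M) t, fun δ hδ x hx ↦ ?_⟩
  rw [longRangeSum_eq_integral W T hδ.1, ← Real.norm_eq_abs]
  refine norm_integral_le_of_norm_le ((integrable_indicator_Icc_const _ _ _).mul_const _)
    (Eventually.of_forall fun s ↦ ?_)
  rw [← integral_const_mul]
  exact norm_integral_le_of_norm_le ((integrable_indicator_Icc_const _ _ _).const_mul _)
    (Eventually.of_forall fun t ↦ hM δ hδ x hx s t)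

/-- The excluded endpoints form a null set. At `s = -T` the equivalence fails, since the site is in
the lattice but `-T` is not in the half-open interval. -/
theorem eventually_site_mem_lattice_iff {T s : ℝ} (hT : 0 < T) (hs : |s| ≠ T) :
    ∀ᶠ δ : ℝ in 𝓝[>] 0, site δ s ∈ lattice (latticeSize δ T) ↔ s ∈ Set.Ioc (-T) T := by
  rcases lt_or_gt_of_ne hs with h | h
  · have h' := abs_lt.1 h
    filter_upwards [self_mem_nhdsWithin] with δ (hδ : 0 < δ)
    exact iff_of_true (site_mem_lattice hδ ⟨h'.1.le, h'.2.le⟩) ⟨h'.1, h'.2.le⟩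
  · have hnot : s ∉ Set.Ioc (-T) T := fun hm ↦ h.not_ge (abs_le.2 ⟨hm.1.le, hm.2⟩)
    have hlim : Tendsto (fun δ : ℝ ↦ T + δ / 2) (𝓝[>] 0) (𝓝 T) := by
      have : Tendsto (fun δ : ℝ ↦ T + δ / 2) (𝓝 0) (𝓝 (T + 0 / 2)) :=
        (tendsto_id.div_const 2).const_add T
      simpa using this.mono_left nhdsWithin_le_nhds
    filter_upwards [hlim.eventually_lt (tendsto_mul_site s).abs h, self_mem_nhdsWithin]
      with δ hlt (hδ : 0 < δ)
    exact iff_of_false (fun hm ↦ hlt.not_ge (mul_abs_le_of_mem_lattice hδ hT.le hm)) hnot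

theorem tendsto_siteKernel {W : ℝ → ℝ} (hW_even : Function.Even W) (hW : Continuous W) {T : ℝ}
    (hT : 0 < T) {x : ℝ → ℝ} {s t : ℝ} (hxs : ContinuousAt x s) (hxt : ContinuousAt x t)
    (hs : |s| ≠ T) (ht : |t| ≠ T) (hst : s ≠ t) :
    Tendsto (fun δ ↦ siteKernel W T δ (fun i ↦ x (Real.artanh δ * i)) (site δ s) (site δ t))
      (𝓝[>] 0) (𝓝 ((Set.Ioc (-T) T).indicator
        (fun s ↦ (Set.Ioc (-T) T).indicator (fun t ↦ W (t - s) * x t * x s) t) s)) := by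
  have hW' : Tendsto (fun δ ↦ W (δ * (site δ s - site δ t))) (𝓝[>] 0) (𝓝 (W (t - s))) := by
    have h := (hW.tendsto (s - t)).comp ((tendsto_mul_site s).sub (tendsto_mul_site t))
    rw [← hW_even (t - s), neg_sub]
    refine h.congr fun δ ↦ ?_
    simp [mul_sub]
  have hx := (hxs.tendsto.comp (tendsto_artanh_mul_site s)).mul
    (hxt.tendsto.comp (tendsto_artanh_mul_site t))
  have hlim := hW'.mul hx
  -- The lattice sum omits the diagonal. Distinct times eventually have distinct sites, and for
  -- fixed `s` the time `t = s` is negligible.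
  have hne : ∀ᶠ δ : ℝ in 𝓝[>] 0, site δ s ≠ site δ t := by
    have h := ((tendsto_mul_site s).sub (tendsto_mul_site t)).eventually_ne (sub_ne_zero.2 hst)
    filter_upwards [h] with δ hδ heq
    exact hδ (by rw [heq, sub_self])
  by_cases hmem : s ∈ Set.Ioc (-T) T ∧ t ∈ Set.Ioc (-T) T
  · rw [Set.indicator_of_mem hmem.1, Set.indicator_of_mem hmem.2,
      show W (t - s) * x t * x s = W (t - s) * (x s * x t) by ring]
    refine hlim.congr' ?_
    filter_upwards [hne, eventually_site_mem_lattice_iff hT hs,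
      eventually_site_mem_lattice_iff hT ht] with δ h1 h2 h3
    rw [siteKernel, if_pos ⟨h2.2 hmem.1, h3.2 hmem.2, h1⟩]
    rfl
  · have hzero : (Set.Ioc (-T) T).indicator
        (fun s ↦ (Set.Ioc (-T) T).indicator (fun t ↦ W (t - s) * x t * x s) t) s = 0 := by
      by_cases h : s ∈ Set.Ioc (-T) T
      · rw [Set.indicator_of_mem h, Set.indicator_of_notMem fun h' ↦ hmem ⟨h, h'⟩]
      · rw [Set.indicator_of_notMem h]
    rw [hzero]
    refine tendsto_const_nhds.congr' ?_
    filter_upwards [eventually_site_mem_lattice_iff hT hs,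
      eventually_site_mem_lattice_iff hT ht] with δ h2 h3
    rw [siteKernel, if_neg]
    exact fun h ↦ hmem ⟨h2.1 h.1, h3.1 h.2.1⟩

/-- Riemann sums of the double integral along a path with few discontinuities. -/
theorem tendsto_longRangeSum {W : ℝ → ℝ} (hW_even : Function.Even W) (hW : Continuous W) {T : ℝ}
    (hT : 0 < T) {x : ℝ → ℝ} (hx : ∀ t, |x t| ≤ 1) (hxc : ∀ᵐ t, ContinuousAt x t) :
    Tendsto (fun δ ↦ longRangeSum W δ (latticeSize δ T) fun i ↦ x (Real.artanh δ * i))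
      (𝓝[>] 0) (𝓝 (∫ s in (-T)..T, ∫ t in (-T)..T, W (t - s) * x t * x s)) := by
  obtain ⟨M, hM⟩ := exists_norm_siteKernel_le hW hT
  have hTT : -T ≤ T := by linarith
  have hgood : ∀ᵐ t : ℝ, |t| ≠ T := by
    have h : ({T, -T} : Set ℝ).Countable := (Set.toFinite _).countable
    filter_upwards [h.ae_notMem volume] with t ht habs
    rcases eq_or_eq_neg_of_abs_eq habs with h | h <;> simp [h] at ht
  have hint : ∫ s in (-T)..T, ∫ t in (-T)..T, W (t - s) * x t * x s
      = ∫ s, ∫ t, (Set.Ioc (-T) T).indicator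
        (fun s ↦ (Set.Ioc (-T) T).indicator (fun t ↦ W (t - s) * x t * x s) t) s := by
    rw [intervalIntegral.integral_of_le hTT, ← integral_indicator measurableSet_Ioc]
    refine integral_congr_ae (Eventually.of_forall fun s ↦ ?_)
    by_cases hs : s ∈ Set.Ioc (-T) T
    · simp only [Set.indicator_of_mem hs]
      rw [intervalIntegral.integral_of_le hTT, ← integral_indicator measurableSet_Ioc]
    · simp [Set.indicator_of_notMem hs]
  rw [hint]
  have heq : ∀ᶠ δ : ℝ in 𝓝[>] 0,
      ∫ s, ∫ t, siteKernel W T δ (fun i ↦ x (Real.artanh δ * i)) (site δ s) (site δ t)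
      = longRangeSum W δ (latticeSize δ T) fun i ↦ x (Real.artanh δ * i) := by
    filter_upwards [self_mem_nhdsWithin] with δ hδ
    exact (longRangeSum_eq_integral W T hδ _).symm
  refine Tendsto.congr' heq ?_
  set I := Set.Icc (-(T + 1)) (T + 1)
  refine tendsto_integral_filter_of_dominated_convergence
    (fun s ↦ I.indicator (fun _ ↦ 1) s * ∫ t, I.indicator (fun _ ↦ M) t) ?_ ?_
    ((integrable_indicator_Icc_const _ _ _).mul_const _) ?_
  -- The integrand depends on `s` only through an integer, so measurability needs nothing about `x`.
  · refine Eventually.of_forall fun δ ↦ Measurable.aestronglyMeasurable ?_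
    exact (measurable_from_top (f := fun i : ℤ ↦ ∫ t,
      siteKernel W T δ (fun i ↦ x (Real.artanh δ * i)) i (site δ t))).comp (measurable_site δ)
  · filter_upwards [eventually_mem_Ioo_zero_one] with δ hδ
    refine Eventually.of_forall fun s ↦ ?_
    rw [← integral_const_mul]
    exact norm_integral_le_of_norm_le ((integrable_indicator_Icc_const _ _ _).const_mul _)
      (Eventually.of_forall fun t ↦ hM δ hδ _ (fun _ ↦ hx _) s t)
  · filter_upwards [hgood, hxc] with s hs hxs
    refine tendsto_integral_filter_of_dominated_convergence
      (fun t ↦ I.indicator (fun _ ↦ 1) s * I.indicator (fun _ ↦ M) t) ?_ ?_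
      ((integrable_indicator_Icc_const _ _ _).const_mul _) ?_
    · refine Eventually.of_forall fun δ ↦ Measurable.aestronglyMeasurable ?_
      exact (measurable_from_top (f := fun j : ℤ ↦
        siteKernel W T δ (fun i ↦ x (Real.artanh δ * i)) (site δ s) j)).comp (measurable_site δ)
    · filter_upwards [eventually_mem_Ioo_zero_one] with δ hδ
      exact Eventually.of_forall fun t ↦ hM δ hδ _ (fun _ ↦ hx _) s t
    · have hne : ∀ᵐ t : ℝ, s ≠ t := by
        filter_upwards [(Set.countable_singleton s).ae_notMem volume] with t ht h
        exact ht h.symm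
      filter_upwards [hgood, hxc, hne] with t ht hxt hst
      exact tendsto_siteKernel hW_even hW hT hxs hxt hs ht hst

/-! ### Passage to the limit under the expectation -/

section Limit

variable {Ω : Type*} [MeasurableSpace Ω] {P : Measure Ω} {N : ℝ → Ω → ℤ} {B : Ω → ℝ}

theorem continuousAt_jumpProcess {Ω : Type*} {N : ℝ → Ω → ℤ} (B : Ω → ℝ) {ω : Ω} {t : ℝ}
    (h : ContinuousAt (fun s ↦ N s ω) t) : ContinuousAt (fun s ↦ jumpProcess B N s ω) t :=
  continuousAt_const.mul
    ((continuous_of_discreteTopology (f := fun z : ℤ ↦ (-1 : ℝ) ^ z)).continuousAt.comp h)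

theorem measurable_longRangeSum (hB : Measurable B) (hN : IsTwoSidedPoissonProcess N P)
    (W : ℝ → ℝ) (δ h : ℝ) (L : ℕ) :
    Measurable fun ω ↦ longRangeSum W δ L fun i ↦ jumpProcess B N (h * i) ω := by
  unfold longRangeSum
  refine Finset.measurable_sum _ fun i _ ↦ Finset.measurable_sum _ fun j _ ↦ ?_
  split_ifs
  · exact measurable_const
  · exact ((measurable_jumpProcess hB hN _).mul (measurable_jumpProcess hB hN _)).const_mul _

theorem tendsto_integral_jumpProcess [IsProbabilityMeasure P]
    (hN : IsTwoSidedPoissonProcess N P) (hB : Measurable B)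
    (hB_pos : P {ω | B ω = 1} = 1 / 2) (hB_neg : P {ω | B ω = -1} = 1 / 2)
    {W : ℝ → ℝ} (hW_even : Function.Even W) (hW_cont : Continuous W)
    {T : ℝ} (hT : 0 < T) {n : ℕ} (t : Fin n → ℝ) :
    Tendsto (fun δ ↦ ∫ ω, (∏ k, jumpProcess B N (Real.artanh δ * site δ (t k)) ω) *
        Real.exp (longRangeSum W δ (latticeSize δ T)
          fun i ↦ jumpProcess B N (Real.artanh δ * i) ω) ∂P) (𝓝[>] 0)
      (𝓝 (∫ ω, (∏ k, jumpProcess B N (t k) ω) * pathWeight W T (jumpProcess B N) ω ∂P)) := by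
  obtain ⟨C, hC⟩ := exists_abs_longRangeSum_le hW_cont hT
  have hae := IsTwoSidedPoissonProcess.ae_eq_one_or_neg_one hB hB_pos hB_neg
  have habs : ∀ {ω}, B ω = 1 ∨ B ω = -1 → ∀ s, abs (jumpProcess B N s ω) = 1 := by
    intro ω hω s
    rcases jumpProcess_eq_one_or_neg_one (N := N) hω s with h | h <;> simp [h]
  refine tendsto_integral_filter_of_dominated_convergence (fun _ ↦ Real.exp C) ?_ ?_
    (integrable_const _) ?_
  · refine Eventually.of_forall fun δ ↦ Measurable.aestronglyMeasurable ?_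
    exact (Finset.measurable_prod _ fun k _ ↦ measurable_jumpProcess hB hN _).mul
      (measurable_longRangeSum hB hN W δ _ _).exp
  · filter_upwards [eventually_mem_Ioo_zero_one] with δ hδ
    filter_upwards [hae] with ω hω
    rw [norm_mul, norm_prod]
    simp only [Real.norm_eq_abs, habs hω, Finset.prod_const_one, one_mul, Real.abs_exp]
    exact Real.exp_le_exp.2 ((le_abs_self _).trans (hC δ hδ _ fun i ↦ (habs hω _).le))
  · filter_upwards [hae, hN.paths, ae_all_iff.2 fun k ↦ hN.ae_continuousAt (t k)]
      with ω hω hpath hcont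
    refine Tendsto.mul (tendsto_finsetProd _ fun k _ ↦ ?_) ?_
    · exact (continuousAt_jumpProcess B (hcont k)).tendsto.comp (tendsto_artanh_mul_site (t k))
    · refine (Real.continuous_exp.tendsto _).comp ?_
      refine tendsto_longRangeSum hW_even hW_cont hT (x := fun s ↦ jumpProcess B N s ω)
        (fun s ↦ (habs hω s).le) ?_
      -- A monotone path has countably many discontinuities, which suffices inside the double
      -- integral. At the given times `t k`, by contrast, almost sure continuity is required.
      filter_upwards [hpath.1.countable_not_continuousAt.ae_notMem volume] with s hs
      exact continuousAt_jumpProcess B (not_not.1 hs)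

/-- The approximating partition functions are at least `exp (-C)`, uniformly in `δ`, and this bound
survives the limit. Neither the limiting double integral nor the integrability of its exponential
has to be examined. -/
theorem jumpPartition_pos [IsProbabilityMeasure P]
    (hN : IsTwoSidedPoissonProcess N P) (hB : Measurable B)
    (hB_pos : P {ω | B ω = 1} = 1 / 2) (hB_neg : P {ω | B ω = -1} = 1 / 2)
    {W : ℝ → ℝ} (hW_even : Function.Even W) (hW_cont : Continuous W)
    {T : ℝ} (hT : 0 < T) : 0 < jumpPartition W T (jumpProcess B N) P := by
  obtain ⟨C, hC⟩ := exists_abs_longRangeSum_le hW_cont hT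
  have hlim := tendsto_integral_jumpProcess hN hB hB_pos hB_neg hW_even hW_cont hT
    (Fin.elim0 : Fin 0 → ℝ)
  simp only [Finset.univ_eq_empty, Finset.prod_empty, one_mul] at hlim
  refine (Real.exp_pos (-C)).trans_le (ge_of_tendsto hlim ?_)
  filter_upwards [eventually_mem_Ioo_zero_one] with δ hδ
  have hle : ∀ᵐ ω ∂P, |longRangeSum W δ (latticeSize δ T)
      fun i ↦ jumpProcess B N (Real.artanh δ * i) ω| ≤ C := by
    filter_upwards [IsTwoSidedPoissonProcess.ae_eq_one_or_neg_one hB hB_pos hB_neg] with ω hω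
    refine hC δ hδ _ fun i ↦ ?_
    rcases jumpProcess_eq_one_or_neg_one (N := N) hω (Real.artanh δ * i) with h | h <;> simp [h]
  have hint : Integrable (fun ω ↦ Real.exp (longRangeSum W δ (latticeSize δ T)
      fun i ↦ jumpProcess B N (Real.artanh δ * i) ω)) P := by
    refine Integrable.of_bound
      (measurable_longRangeSum hB hN W δ _ _).exp.aestronglyMeasurable (Real.exp C) ?_
    filter_upwards [hle] with ω hω
    rw [Real.norm_eq_abs, Real.abs_exp]
    exact Real.exp_le_exp.2 ((le_abs_self _).trans hω)
  calc Real.exp (-C) = ∫ _, Real.exp (-C) ∂P := by simp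
    _ ≤ _ := by
      refine integral_mono_ae (integrable_const _) hint ?_
      filter_upwards [hle] with ω hω
      exact Real.exp_le_exp.2 (abs_le.1 hω).1

end Limit

end ContinuumIsing

theorem mainTheorem3 {Ω : Type*} [MeasurableSpace Ω] (P : Measure Ω) [IsProbabilityMeasure P]
    (N : ℝ → Ω → ℤ) (hN : IsTwoSidedPoissonProcess N P)
    (B : Ω → ℝ) (hB : Measurable B)
    (hB_pos : P {ω | B ω = 1} = 1 / 2) (hB_neg : P {ω | B ω = -1} = 1 / 2)
    (hBN : IndepFun B (fun ω t ↦ N t ω) P)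
    (W : ℝ → ℝ) (hW_even : Function.Even W) (hW_cont : Continuous W)
    (T : ℝ) (hT : 0 < T)
    (n : ℕ) (t : Fin n → ℝ) (ht_mono : Monotone t) (ht : ∀ k, t k ∈ Set.Icc (-T) T) :
    Tendsto (fun δ : ℝ ↦ latticeCorrelation W T δ t) (𝓝[>] 0)
      (𝓝 ((jumpPartition W T (jumpProcess B N) P)⁻¹ *
        ∫ ω, (∏ k, jumpProcess B N (t k) ω) * pathWeight W T (jumpProcess B N) ω ∂P)) := by
  have hnum := tendsto_integral_jumpProcess hN hB hB_pos hB_neg hW_even hW_cont hT t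
  -- With no times the product is `1`, so the same limit theorem yields the denominator.
  have hden := tendsto_integral_jumpProcess hN hB hB_pos hB_neg hW_even hW_cont hT
    (Fin.elim0 : Fin 0 → ℝ)
  simp only [Finset.univ_eq_empty, Finset.prod_empty, one_mul] at hden
  have hpos := jumpPartition_pos hN hB hB_pos hB_neg hW_even hW_cont hT
  refine ((hden.inv₀ hpos.ne').mul hnum).congr' ?_
  filter_upwards [eventually_mem_Ioo_zero_one] with δ hδ
  exact (latticeCorrelation_eq hN hB hB_pos hB_neg hBN hW_even hδ ht).symm
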